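/- Fix $T>0$. An input of the perfect one-cold Poisson channel (perfect OCPC) of duration $T$ is a measurable function $x:[0,T]\to\{1,2,\ldots\}$; given $x$, the output is a sequence of independent Poisson counting processes $Y=(Y_i(t))_{t\in[0,T]}$, $i=1,2,\ldots$, where $Y_i$ has intensity $\mathbf 1\{x(t)\neq i\}$ at time $t$. Let $P_{Y|X}(\cdot|x)$ be the law of the output. A simulation scheme with $\mathsf M\in\{1,2,\ldots\}$ messages and unlimited common randomness consists of a random element $W$ (with arbitrary law) shared by an encoder and a decoder, an encoder $K=f(W,x)\in\{1,\ldots,\mathsf M\}$ and a decoder $\hat Y=g(W,K)$. It simulates the channel within $\epsilon$ if for every input $x$ the total variation distance between the law of $g(W,f(W,x))$ and $P_{Y|X}(\cdot|x)$ is at most $\epsilon$. Let $\mathsf M^*_{\mathrm{sim}}(\infty,0,T,\epsilon)$ be the smallest $\mathsf M\ge 1$ for which some scheme with $\mathsf M$ messages simulates the perfect OCPC of duration $T$ within $\epsilon$, and let $\epsilon^*_{\mathrm{sim}}(\infty,0,T,\mathsf M):=\inf\{\epsilon\ge0:\mathsf M^*_{\mathrm{sim}}(\infty,0,T,\epsilon)\le\mathsf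 M\}$. Theorem. For every $T>0$ and every integer $\mathsf M\ge1$, \[ \epsilon^*_{\mathrm{sim}}(\infty,0,T,\mathsf M)\le(1-e^{-T})^{\mathsf M}\le\exp(-e^{-T}\mathsf M). \] As a result, for every $0<\epsilon<1$, $\mathsf M^*_{\mathrm{sim}}(\infty,0,T,\epsilon)$ is finite and \[ \ln\mathsf M^*_{\mathrm{sim}}(\infty,0,T,\epsilon)\le\max\{T+\ln\ln(1/\epsilon)+\ln2,\,0\}. \] In particular $\ln\mathsf M^*_{\mathrm{sim}}(\infty,0,T,\epsilon)\le T+\ln\ln(1/\epsilon)+\ln 2$ whenever the right-hand side is nonnegative, e.g. for all $0<\epsilon\le e^{-1/2}$. -/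

import Mathlib

open MeasureTheory ProbabilityTheory Set
open scoped NNReal ENNReal

noncomputable section

namespace OCPC

/-- The set of bands `[L] = {1, …, L}`; for `L = ⊤` this is `{1, 2, 3, …}`. -/
abbrev Band (L : ℕ∞) : Type := {i : ℕ // 1 ≤ i ∧ (i : ℕ∞) ≤ L}

/-- Channel inputs: measurable functions `x : [0,T] → [L]`. -/
abbrev Input (L : ℕ∞) (T : ℝ) : Type := {x : Icc (0 : ℝ) T → Band L // Measurable x}

/-- Paths of counting processes on `[0,T]`: nondecreasing right-continuous functions
`[0,T] → {0, 1, 2, …}` that start at `0`. The σ-algebra is the one generated by the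
evaluations `y ↦ y t`. -/
abbrev CountingPath (T : ℝ) : Type :=
  {y : Icc (0 : ℝ) T → ℕ //
    (∀ t : Icc (0 : ℝ) T, (t : ℝ) = 0 → y t = 0) ∧ Monotone y ∧
      ∀ t, ContinuousWithinAt y (Ici t) t}

/-- Channel outputs: one counting path for every band, with the product σ-algebra. -/
abbrev Output (L : ℕ∞) (T : ℝ) : Type := Band L → CountingPath T

/-- The intensity `1 - (1 - α) 𝟏{x(τ) = i}` of the process in band `i` at time `τ`. -/
def intensity {L : ℕ∞} {T : ℝ} (α : ℝ≥0) (x : Input L T) (i : Band L)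
    (τ : Icc (0 : ℝ) T) : ℝ :=
  1 - (1 - (α : ℝ)) * (if x.1 τ = i then 1 else 0)

/-- The mean number of points in band `i` between the times `s` and `t`, namely
`∫_s^t (1 - (1 - α) 𝟏{x(τ) = i}) dτ`. -/
def mean {L : ℕ∞} {T : ℝ} (α : ℝ≥0) (x : Input L T) (i : Band L)
    (s t : Icc (0 : ℝ) T) : ℝ≥0 :=
  (∫ τ in Ioc s t, intensity α x i τ ∂(volume.comap Subtype.val)).toNNReal

/-- `Q` is the conditional law of the output of the `(L, α)`-OCPC with duration `T` given the
input `x`: under `Q` the processes `Y_i`, `i ∈ [L]`, are independent, and each `Y_i` is a Poisson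
counting process with intensity function `τ ↦ 1 - (1 - α) 𝟏{x(τ) = i}`. -/
structure IsChannelLaw {L : ℕ∞} {T : ℝ} (α : ℝ≥0) (x : Input L T)
    (Q : Measure (Output L T)) : Prop where
  isProbabilityMeasure : IsProbabilityMeasure Q
  iIndepFun_band : iIndepFun (fun (i : Band L) (y : Output L T) => y i) Q
  indep_increments : ∀ i : Band L,
    HasIndepIncrements (fun (t : Icc (0 : ℝ) T) (y : Output L T) => (y i).1 t) Q
  increment_law : ∀ (i : Band L) (s t : Icc (0 : ℝ) T), s < t →
    HasLaw (fun y : Output L T => (y i).1 t - (y i).1 s) (poissonMeasure (mean α x i s t)) Q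

/-- Total variation distance `sup_A |P(A) - Q(A)|` over measurable sets `A`
(for probability measures `P`, `Q`). -/
def tvDist {Y : Type*} [MeasurableSpace Y] (P Q : Measure Y) : ℝ :=
  ⨆ A : {A : Set Y // MeasurableSet A}, |P.real A.1 - Q.real A.1|

/-- A channel simulation scheme with unlimited common randomness and `M` messages:
the common randomness `w` with an arbitrary law, the encoder `(w, x) ↦ k = f(w, x) ∈ [M]` and the
decoder `(w, k) ↦ ŷ = g(w, k)`. -/
structure SimScheme (L : ℕ∞) (T : ℝ) (M : ℕ) where
  /-- the space of the common randomness -/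
  W : Type
  [measurableSpace : MeasurableSpace W]
  /-- the law of the common randomness -/
  law : Measure W
  [isProbabilityMeasure : IsProbabilityMeasure law]
  /-- the encoder -/
  f : W → Input L T → Fin M
  measurable_f : ∀ x, Measurable (fun w => f w x)
  /-- the decoder -/
  g : W → Fin M → Output L T
  measurable_g : ∀ k, Measurable (fun w => g w k)

attribute [instance] SimScheme.measurableSpace SimScheme.isProbabilityMeasure

/-- The law of the simulated output `ŷ = g(w, f(w, x))` given the input `x`. -/
def SimScheme.outputLaw {L : ℕ∞} {T : ℝ} {M : ℕ} (S : SimScheme L T M) (x : Input L T) :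
    Measure (Output L T) :=
  S.law.map (fun w => S.g w (S.f w x))

/-- The `(L, α)`-OCPC with duration `T` can be simulated with `M` messages within total variation
distance `ε`, for every input `x`. -/
def Simulable (L : ℕ∞) (α : ℝ≥0) (T : ℝ) (M : ℕ) (ε : ℝ) : Prop :=
  ∃ S : SimScheme L T M, ∀ x : Input L T, ∃ Q : Measure (Output L T),
    IsChannelLaw α x Q ∧ tvDist (S.outputLaw x) Q ≤ ε

/-- `M*_sim(L, α, T, ε)`: the smallest `M ∈ {1, 2, …}` such that the channel can be simulated with
`M` messages within total variation distance `ε` (and `⊤` if there is none). -/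
def Msim (L : ℕ∞) (α : ℝ≥0) (T : ℝ) (ε : ℝ) : ℕ∞ :=
  ⨅ (M : ℕ) (_ : 1 ≤ M ∧ Simulable L α T M ε), (M : ℕ∞)

/-- `ε*_sim(L, α, T, M) = inf {ε ≥ 0 : M*_sim(L, α, T, ε) ≤ M}`, as an extended nonnegative
number (the infimum of the empty set is `⊤`). -/
def epsSim (L : ℕ∞) (α : ℝ≥0) (T : ℝ) (M : ℕ) : ℝ≥0∞ :=
  ⨅ (ε : ℝ≥0) (_ : Msim L α T ε ≤ M), (ε : ℝ≥0∞)

end OCPC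

end

/-!
Rejection sampling. Encoder and decoder share `M` independent samples of independent rate-one
Poisson processes in all bands, and the encoder sends the index of the first sample without a point
in the band blocked by `x` at that time. The blocked sets `x ⁻¹' {i}` partition `[0,T]`, so whatever
the input, a sample is accepted with probability `∏ i, exp (-|x ⁻¹' {i}|) = exp (-T)`; and a Poisson
process conditioned to have no point in a set is a Poisson process on the complement, so an accepted
sample has exactly the law of the channel output. The output is therefore correct unless all `M`
samples are rejected, which has probability `(1 - exp (-T)) ^ M`.
-/

namespace OCPC

noncomputable section PoissonProcess

variable {E : Type*}

/-- A finite configuration of points of `E`: the first coordinate is the number of points, and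
only that many entries of the sequence in the second coordinate are points of the configuration. -/
abbrev PointConfig (E : Type*) : Type _ := ℕ × (ℕ → E)

/-- The number of points in `C`, with multiplicity. -/
def count (C : Set E) (ω : PointConfig E) : ℕ :=
  ∑ j ∈ Finset.range ω.1, C.indicator 1 (ω.2 j)

lemma count_mono {C D : Set E} (h : C ⊆ D) (ω : PointConfig E) : count C ω ≤ count D ω :=
  Finset.sum_le_sum fun _ _ => indicator_le_indicator_of_subset h (fun _ => Nat.zero_le _) _

lemma count_union {C D : Set E} (h : Disjoint C D) (ω : PointConfig E) :
    count (C ∪ D) ω = count C ω + count D ω := by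
  simp only [count, indicator_union_of_disjoint h, Finset.sum_add_distrib]

lemma cast_count (C : Set E) (ω : PointConfig E) :
    (count C ω : ℝ) = ∑ j ∈ Finset.range ω.1, C.indicator 1 (ω.2 j) := by
  rw [count, Nat.cast_sum]
  refine Finset.sum_congr rfl fun j _ => ?_
  by_cases hj : ω.2 j ∈ C <;> simp [hj]

lemma prod_indicator_compl (B : Set E) (h : E → ℂ) (ω : PointConfig E) :
    ∏ j ∈ Finset.range ω.1, Bᶜ.indicator h (ω.2 j) =
      (count B ⁻¹' {0}).indicator (fun ω => ∏ j ∈ Finset.range ω.1, h (ω.2 j)) ω := by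
  have hzero : ω ∈ count B ⁻¹' {0} ↔ ∀ j ∈ Finset.range ω.1, ω.2 j ∉ B := by simp [count]
  by_cases hω : ω ∈ count B ⁻¹' {0}
  · rw [indicator_of_mem hω]
    exact Finset.prod_congr rfl fun j hj => indicator_of_mem (hzero.1 hω j hj) h
  · rw [indicator_of_notMem hω]
    obtain ⟨j, hj, hjB⟩ : ∃ j ∈ Finset.range ω.1, ω.2 j ∈ B := by
      simpa only [not_forall, not_not, exists_prop] using mt hzero.2 hω
    exact Finset.prod_eq_zero hj (indicator_of_notMem (not_not_intro hjB) h)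

lemma exp_sum_indicator_sub_one {ι : Type*} [Fintype ι] {C : ι → Set E}
    (hd : Pairwise (Function.onFun Disjoint C)) (s : ι → ℝ) (u : E) :
    Complex.exp ((∑ l, s l * (C l).indicator 1 u : ℝ) * Complex.I) - 1 =
      ∑ l, (C l).indicator (fun _ => Complex.exp (s l * Complex.I) - 1) u := by
  classical
  by_cases hu : ∃ l, u ∈ C l
  · obtain ⟨l, hl⟩ := hu
    have hne (m : ι) (hm : m ≠ l) : u ∉ C m := fun hmu => disjoint_left.1 (hd hm) hmu hl
    rw [Finset.sum_eq_single l (fun m _ hm => by simp [hne m hm]) (by simp),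
      Finset.sum_eq_single l (fun m _ hm => by simp [hne m hm]) (by simp)]
    simp [hl]
  · push Not at hu
    simp [hu]

variable [MeasurableSpace E]

lemma measurable_count {C : Set E} (hC : MeasurableSet C) : Measurable (count C) :=
  measurable_from_prod_countable_right fun n =>
    Finset.measurable_sum (f := fun j (u : ℕ → E) => C.indicator (1 : E → ℕ) (u j))
      (Finset.range n) fun j _ => (measurable_one.indicator hC).comp (measurable_pi_apply j)

lemma measurableSet_count_eq_zero {C : Set E} (hC : MeasurableSet C) :
    MeasurableSet (count C ⁻¹' {0}) :=
  measurable_count hC (measurableSet_singleton 0)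

/-- `P` is the law of a Poisson process on `E` with the finite intensity measure `ν`, characterised
by its probability generating functional `h ↦ 𝔼 ∏ h(point) = exp (∫ (h - 1) dν)`. -/
def IsPoissonProcess (P : Measure (PointConfig E)) (ν : Measure E) : Prop :=
  ∀ h : E → ℂ, Measurable h → (∀ u, ‖h u‖ ≤ 1) →
    ∫ ω, ∏ j ∈ Finset.range ω.1, h (ω.2 j) ∂P = Complex.exp (∫ u, (h u - 1) ∂ν)

namespace IsPoissonProcess

variable {P : Measure (PointConfig E)} {ν : Measure E}

lemma isProbabilityMeasure (hP : IsPoissonProcess P ν) : IsProbabilityMeasure P := by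
  have hone := hP 1 measurable_one fun u => by simp
  simp only [Pi.one_apply, Finset.prod_const_one, sub_self, integral_zero, Complex.exp_zero,
    integral_const, Complex.real_smul, mul_one, Complex.ofReal_eq_one] at hone
  exact isProbabilityMeasure_iff_real.2 hone

lemma real_count_eq_zero (hP : IsPoissonProcess P ν) {B : Set E} (hB : MeasurableSet B) :
    P.real (count B ⁻¹' {0}) = Real.exp (-ν.real B) := by
  have hvoid := hP (Bᶜ.indicator 1) (measurable_one.indicator hB.compl) fun u => by
    by_cases hu : u ∈ B <;> simp [hu]
  have hsub (u : E) : Bᶜ.indicator (1 : E → ℂ) u - 1 = B.indicator (fun _ => -1) u := by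
    by_cases hu : u ∈ B <;> simp [hu]
  simp only [prod_indicator_compl, Pi.one_apply, Finset.prod_const_one, hsub,
    integral_indicator_const _ hB,
    integral_indicator_const _ (measurableSet_count_eq_zero hB)] at hvoid
  simpa [← Complex.ofReal_neg, ← Complex.ofReal_exp] using hvoid

variable [IsFiniteMeasure ν]

lemma cond_count_eq_zero (hP : IsPoissonProcess P ν) {B : Set E} (hB : MeasurableSet B) :
    IsPoissonProcess P[|count B ⁻¹' {0}] (ν.restrict Bᶜ) := fun h hm h1 => by
  have hint : Integrable (fun u => h u - 1) ν :=
    (Integrable.of_bound hm.aestronglyMeasurable 1 (ae_of_all _ h1)).sub (integrable_const 1)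
  have hsub (u : E) : Bᶜ.indicator h u - 1 =
      Bᶜ.indicator (fun u => h u - 1) u + B.indicator (fun _ => -1) u := by
    by_cases hu : u ∈ B <;> simp [hu]
  have hsplit : ∫ u, (Bᶜ.indicator h u - 1) ∂ν = (∫ u in Bᶜ, (h u - 1) ∂ν) - ν.real B := by
    simp_rw [hsub]
    rw [integral_add (hint.indicator hB.compl) ((integrable_const _).indicator hB),
      integral_indicator hB.compl, integral_indicator_const _ hB, smul_neg, Complex.real_smul,
      mul_one, sub_eq_add_neg]
  have hrestrict := hP (Bᶜ.indicator h) (hm.indicator hB.compl) fun u =>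
    (norm_indicator_le_norm_self h u).trans (h1 u)
  simp_rw [prod_indicator_compl, hsplit] at hrestrict
  rw [ProbabilityTheory.cond, integral_smul_measure,
    ← integral_indicator (measurableSet_count_eq_zero hB), hrestrict, ENNReal.toReal_inv,
    ← Measure.real, hP.real_count_eq_zero hB, Complex.real_smul, ← Real.exp_neg,
    Complex.ofReal_exp, ← Complex.exp_add, neg_neg, add_sub_cancel]

lemma integral_exp_sum_count (hP : IsPoissonProcess P ν) {ι : Type*} [Fintype ι] {C : ι → Set E}
    (hC : ∀ l, MeasurableSet (C l)) (hd : Pairwise (Function.onFun Disjoint C)) (s : ι → ℝ) :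
    ∫ ω, Complex.exp ((∑ l, s l * count (C l) ω : ℝ) * Complex.I) ∂P =
      ∏ l, Complex.exp (ν.real (C l) * (Complex.exp (s l * Complex.I) - 1)) := by
  set h : E → ℂ := fun u =>
    Complex.exp ((∑ l, s l * (C l).indicator 1 u : ℝ) * Complex.I) with h_def
  have hm : Measurable h := by
    have (l : ι) : Measurable ((C l).indicator (1 : E → ℝ)) := measurable_one.indicator (hC l)
    fun_prop
  have hprod (ω : PointConfig E) : ∏ j ∈ Finset.range ω.1, h (ω.2 j) =
      Complex.exp ((∑ l, s l * count (C l) ω : ℝ) * Complex.I) := by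
    simp_rw [h_def, ← Complex.exp_sum, ← Finset.sum_mul, ← Complex.ofReal_sum, cast_count,
      Finset.mul_sum]
    rw [Finset.sum_comm]
  have hsub (u : E) : h u - 1 =
      ∑ l, (C l).indicator (fun _ => Complex.exp (s l * Complex.I) - 1) u :=
    exp_sum_indicator_sub_one hd s u
  have hpgfl := hP h hm fun u => (Complex.norm_exp_ofReal_mul_I _).le
  simp_rw [hprod, hsub] at hpgfl
  rw [hpgfl, integral_finsetSum _ fun l _ => (integrable_const _).indicator (hC l),
    Complex.exp_sum]
  simp_rw [integral_indicator_const _ (hC _), Complex.real_smul]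

lemma charFun_map_count (hP : IsPoissonProcess P ν) {C : Set E} (hC : MeasurableSet C) (s : ℝ) :
    charFun (P.map fun ω => (count C ω : ℝ)) s =
      Complex.exp (ν.real C * (Complex.exp (s * Complex.I) - 1)) := by
  have hm : Measurable fun ω => (count C ω : ℝ) := measurable_from_nat.comp (measurable_count hC)
  rw [charFun_apply, integral_map hm.aemeasurable (by fun_prop)]
  simpa [mul_comm] using hP.integral_exp_sum_count (ι := Unit) (fun _ => hC)
    Subsingleton.pairwise fun _ => s

lemma hasLaw_count (hP : IsPoissonProcess P ν) {C : Set E} (hC : MeasurableSet C) :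
    HasLaw (count C) (poissonMeasure (ν C).toNNReal) P := by
  have := hP.isProbabilityMeasure
  have hm := measurable_count hC
  have := Measure.isProbabilityMeasure_map (μ := P) hm.aemeasurable
  have hcast : Measurable (Nat.cast : ℕ → ℝ) := measurable_from_nat
  refine ⟨hm.aemeasurable, (MeasurableEmbedding.natCast (α := ℝ)).map_injective ?_⟩
  have := Measure.isProbabilityMeasure_map (μ := P.map (count C)) hcast.aemeasurable
  refine Measure.ext_of_charFun (funext fun s => ?_)
  rw [charFun_map_cast_poissonMeasure, Measure.map_map hcast hm]
  exact hP.charFun_map_count hC s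

lemma iIndepFun_count (hP : IsPoissonProcess P ν) {ι : Type*} [Finite ι] {C : ι → Set E}
    (hC : ∀ l, MeasurableSet (C l)) (hd : Pairwise (Function.onFun Disjoint C)) :
    iIndepFun (fun l => count (C l)) P := by
  have := Fintype.ofFinite ι
  have := hP.isProbabilityMeasure
  have hm (l : ι) : Measurable fun ω => (count (C l) ω : ℝ) :=
    measurable_from_nat.comp (measurable_count (hC l))
  have hcast : iIndepFun (fun l ω => (count (C l) ω : ℝ)) P := by
    rw [iIndepFun_iff_charFun_pi fun l => (hm l).aemeasurable]
    intro s
    simp_rw [hP.charFun_map_count (hC _)]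
    have hmL : Measurable fun ω => WithLp.toLp 2 fun l => (count (C l) ω : ℝ) :=
      (WithLp.measurable_toLp 2 (ι → ℝ)).comp (measurable_pi_lambda _ hm)
    rw [← hP.integral_exp_sum_count hC hd, charFun_apply, integral_map hmL.aemeasurable
      (by fun_prop)]
    simp [PiLp.inner_apply]
  simpa [Function.comp_def] using hcast.comp (fun _ x => ⌊x⌋₊) fun _ => Nat.measurable_floor

end IsPoissonProcess

/-- For finite nonzero `ν`, the law of a Poisson number, of mean `ν univ`, of independent points
with the normalised law of `ν`. -/
def poissonPoints (ν : Measure E) : Measure (PointConfig E) :=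
  (poissonMeasure (ν univ).toNNReal).prod (Measure.infinitePi fun _ => ν[|univ])

lemma integral_prod_infinitePi (P : Measure E) [IsProbabilityMeasure P] {h : E → ℂ}
    (hm : Measurable h) (n : ℕ) :
    ∫ u : ℕ → E, ∏ j ∈ Finset.range n, h (u j) ∂(Measure.infinitePi fun _ => P) =
      (∫ u, h u ∂P) ^ n := by
  have hind : iIndepFun (fun (j : Fin n) (u : ℕ → E) => h (u j)) (Measure.infinitePi fun _ => P) :=
    (iIndepFun_infinitePi (P := fun _ : ℕ => P) (X := fun _ => h) fun _ => hm).precomp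
      Fin.val_injective
  have heval (j : ℕ) : ∫ u : ℕ → E, h (u j) ∂(Measure.infinitePi fun _ => P) = ∫ u, h u ∂P := by
    conv_rhs => rw [← Measure.infinitePi_map_eval (fun _ : ℕ => P) j]
    rw [integral_map (measurable_pi_apply j).aemeasurable hm.aestronglyMeasurable]
  simp_rw [Finset.prod_range]
  rw [hind.integral_fun_prod_eq_prod_integral fun j =>
    (hm.comp (measurable_pi_apply _)).aestronglyMeasurable]
  simp [heval]

lemma integral_pow_poissonMeasure (r : ℝ≥0) (z : ℂ) :
    ∫ n, z ^ n ∂(poissonMeasure r) = Complex.exp (r * (z - 1)) := by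
  calc ∫ n, z ^ n ∂(poissonMeasure r)
      = ∑' n : ℕ, (Real.exp (-r) : ℂ) * ((r * z) ^ n / n.factorial) := by
        rw [integral_poissonMeasure]
        congr with n
        rw [Complex.real_smul]
        push_cast
        ring
    _ = Complex.exp (-r) * Complex.exp (r * z) := by
        rw [tsum_mul_left, (NormedSpace.expSeries_div_hasSum_exp ((r : ℂ) * z)).tsum_eq,
          ← Complex.exp_eq_exp_ℂ, Complex.ofReal_exp, Complex.ofReal_neg]
    _ = Complex.exp (r * (z - 1)) := by rw [← Complex.exp_add]; ring_nf

lemma isPoissonProcess_poissonPoints (ν : Measure E) [IsFiniteMeasure ν] [NeZero ν] :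
    IsPoissonProcess (poissonPoints ν) ν := fun h hm h1 => by
  have : IsProbabilityMeasure ν[|univ] := cond_isProbabilityMeasure (NeZero.ne _)
  have hprod : Measurable fun ω : PointConfig E => ∏ j ∈ Finset.range ω.1, h (ω.2 j) :=
    measurable_from_prod_countable_right fun n =>
      Finset.measurable_prod (f := fun j (u : ℕ → E) => h (u j)) (Finset.range n)
        fun j _ => hm.comp (measurable_pi_apply j)
  have hint : Integrable (fun ω : PointConfig E => ∏ j ∈ Finset.range ω.1, h (ω.2 j))
      (poissonPoints ν) := by
    unfold poissonPoints
    refine Integrable.of_bound hprod.aestronglyMeasurable 1 (ae_of_all _ fun ω => ?_)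
    rw [norm_prod]
    exact Finset.prod_le_one (fun _ _ => norm_nonneg _) fun j _ => h1 _
  have hmean : ((ν univ).toNNReal : ℂ) * ((∫ u, h u ∂ν[|univ]) - 1) = ∫ u, (h u - 1) ∂ν := by
    have haverage : ∫ u, h u ∂ν[|univ] = ⨍ u, h u ∂ν := by
      rw [ProbabilityTheory.cond, Measure.restrict_univ, average]
    have hint_h : Integrable h ν :=
      Integrable.of_bound hm.aestronglyMeasurable 1 (ae_of_all _ h1)
    change (ν.real univ : ℂ) * _ = _
    rw [integral_sub hint_h (integrable_const 1), ← measure_smul_average ν h, haverage,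
      integral_const, Complex.real_smul, Complex.real_smul, ← mul_sub]
  unfold poissonPoints at hint ⊢
  rw [integral_prod _ hint]
  simp_rw [integral_prod_infinitePi _ hm]
  rw [integral_pow_poissonMeasure, hmean]

end PoissonProcess

noncomputable section InfiniteProduct

variable {ι : Type*} [Countable ι] {X : ι → Type*} [∀ i, MeasurableSpace (X i)]
  (μ : ∀ i, Measure (X i)) [∀ i, IsProbabilityMeasure (μ i)]

lemma infinitePi_pi_inter_pi {S S' : Set ι} (hS : Disjoint S S') {t t' : ∀ i, Set (X i)}
    (ht : ∀ i, MeasurableSet (t i)) (ht' : ∀ i, MeasurableSet (t' i)) :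
    Measure.infinitePi μ (S.pi t ∩ S'.pi t') =
      Measure.infinitePi μ (S.pi t) * Measure.infinitePi μ (S'.pi t') := by
  have hind : iIndepFun (fun i (ω : ∀ i, X i) => ω i) (Measure.infinitePi μ) :=
    iIndepFun_infinitePi (X := fun _ => id) fun _ => measurable_id
  have hmeas (S : Set ι) {t : ∀ i, Set (X i)} (ht : ∀ i, MeasurableSet (t i)) :
      MeasurableSet[⨆ i ∈ S, MeasurableSpace.comap (fun ω : ∀ i, X i => ω i) inferInstance]
        (S.pi t) := by
    rw [pi_def]
    exact .biInter S.to_countable fun i hi =>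
      le_iSup₂ (f := fun i (_ : i ∈ S) => MeasurableSpace.comap (fun ω : ∀ i, X i => ω i) _) i hi _
        ⟨t i, ht i, rfl⟩
  have hindep := indep_iSup_of_disjoint (fun i => (measurable_pi_apply i).comap_le)
    ((iIndepFun_iff_iIndep _ _ _).1 hind) hS
  exact (Indep_iff _ _ _).1 hindep _ _ (hmeas S ht) (hmeas S' ht')

lemma infinitePi_cond_univ_pi {A : ∀ i, Set (X i)} (hA : ∀ i, MeasurableSet (A i))
    (hne : Measure.infinitePi μ (univ.pi A) ≠ 0) :
    (Measure.infinitePi μ)[|univ.pi A] = Measure.infinitePi fun i => (μ i)[|A i] := by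
  have hfactor (i : ι) : μ i (A i) ≠ 0 := fun h => hne <| by
    rw [← nonpos_iff_eq_zero, ← h, ← Measure.infinitePi_map_eval μ i,
      Measure.map_apply (measurable_pi_apply i) (hA i)]
    exact measure_mono fun ω hω => hω i (mem_univ i)
  have (i : ι) : IsProbabilityMeasure (μ i)[|A i] := cond_isProbabilityMeasure (hfactor i)
  refine Measure.eq_infinitePi _ fun s t ht => ?_
  have hcompl : Disjoint (s : Set ι) (s : Set ι)ᶜ := disjoint_compl_right
  have hAt (i : ι) : MeasurableSet (A i ∩ t i) := (hA i).inter (ht i)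
  have hsplit : univ.pi A = (s : Set ι).pi A ∩ (s : Set ι)ᶜ.pi A := by
    rw [← union_pi, union_compl_self]
  have hsplit_inter : univ.pi A ∩ (s : Set ι).pi t =
      (s : Set ι).pi (fun i => A i ∩ t i) ∩ (s : Set ι)ᶜ.pi A := by
    rw [hsplit, pi_inter_distrib, inter_right_comm]
  have hbox : Measure.infinitePi μ (univ.pi A) =
      (∏ i ∈ s, μ i (A i)) * Measure.infinitePi μ ((s : Set ι)ᶜ.pi A) := by
    rw [hsplit, infinitePi_pi_inter_pi μ hcompl hA hA, Measure.infinitePi_pi μ fun i _ => hA i]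
  have hbox_inter : Measure.infinitePi μ (univ.pi A ∩ (s : Set ι).pi t) =
      (∏ i ∈ s, μ i (A i ∩ t i)) * Measure.infinitePi μ ((s : Set ι)ᶜ.pi A) := by
    rw [hsplit_inter, infinitePi_pi_inter_pi μ hcompl hAt hA,
      Measure.infinitePi_pi μ fun i _ => hAt i]
  have htail : Measure.infinitePi μ ((s : Set ι)ᶜ.pi A) ≠ 0 :=
    right_ne_zero_of_mul (hbox ▸ hne)
  rw [cond_apply (.univ_pi hA), hbox_inter, hbox]
  simp_rw [cond_apply (hA _)]
  rw [Finset.prod_mul_distrib, ← ENNReal.prod_inv_distrib fun i _ _ _ _ => Or.inl (hfactor i),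
    ← ENNReal.div_eq_inv_mul, ENNReal.mul_div_mul_right _ _ htail (measure_ne_top _ _),
    ENNReal.div_eq_inv_mul]

end InfiniteProduct

lemma iIndepFun_map_iff {Ω Ω' ι : Type*} {β : ι → Type*} [MeasurableSpace Ω]
    [MeasurableSpace Ω'] [∀ i, MeasurableSpace (β i)] {P : Measure Ω} [IsProbabilityMeasure P]
    {φ : Ω → Ω'} (hφ : Measurable φ) {X : ∀ i, Ω' → β i} (hX : ∀ i, Measurable (X i)) :
    iIndepFun X (P.map φ) ↔ iIndepFun (fun i ω => X i (φ ω)) P := by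
  have := Measure.isProbabilityMeasure_map (μ := P) hφ.aemeasurable
  have hXφ (i : ι) : Measurable fun ω => X i (φ ω) := (hX i).comp hφ
  rw [iIndepFun_iff_map_fun_eq_infinitePi_map hX, iIndepFun_iff_map_fun_eq_infinitePi_map hXφ,
    Measure.map_map (measurable_pi_lambda _ hX) hφ]
  simp_rw [Measure.map_map (hX _) hφ]
  rfl

noncomputable section RejectionSampling

variable {Ω : Type*} {M : ℕ}

/-- The index of the first sample in `A`, and the last index if there is none. -/
def firstIndex [NeZero M] (A : Set Ω) (w : Fin M → Ω) : Fin M :=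
  sInf {k | w k ∈ A}

lemma firstIndex_eq [NeZero M] {A : Set Ω} {w : Fin M → Ω} {k : Fin M} (hk : w k ∈ A)
    (hlt : ∀ j < k, w j ∉ A) : firstIndex A w = k :=
  IsLeast.csInf_eq ⟨hk, fun j hj => not_lt.1 fun hjk => hlt j hjk hj⟩

variable [MeasurableSpace Ω]

lemma measurable_firstIndex [NeZero M] {A : Set Ω} (hA : MeasurableSet A) :
    Measurable (firstIndex (M := M) A) := by
  have hmem : Measurable fun (w : Fin M → Ω) k => w k ∈ A :=
    measurable_pi_lambda _ fun k => hA.mem.comp (measurable_pi_apply k)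
  exact (Measurable.of_discrete (f := fun p : Fin M → Prop => sInf {k | p k})).comp hmem

variable (μ : Measure Ω) [IsProbabilityMeasure μ]

lemma pi_real_first_mem {A D : Set Ω} (hA : MeasurableSet A) (k : Fin M) :
    (Measure.pi fun _ : Fin M => μ).real {w | w k ∈ D ∧ ∀ j < k, w j ∉ A} =
      (1 - μ.real A) ^ (k : ℕ) * μ.real D := by
  have hbox : {w : Fin M → Ω | w k ∈ D ∧ ∀ j < k, w j ∉ A} =
      univ.pi fun j => if j < k then Aᶜ else if j = k then D else univ := by
    ext w
    refine ⟨fun h j _ => ?_, fun h => ⟨by simpa using h k, fun j hj => by simpa [hj] using h j⟩⟩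
    rcases lt_trichotomy j k with hj | rfl | hj
    · simpa [hj] using h.2 j hj
    · simpa using h.1
    · simp [hj.ne', hj.not_gt]
  have hfactor (j : Fin M) : μ.real (if j < k then Aᶜ else if j = k then D else univ) =
      (if j < k then 1 - μ.real A else 1) * (if j = k then μ.real D else 1) := by
    rcases lt_trichotomy j k with hj | rfl | hj
    · simp [hj, hj.ne, probReal_compl_eq_one_sub hA]
    · simp
    · simp [hj.ne', hj.not_gt]
  rw [hbox, Measure.real, Measure.pi_pi, ENNReal.toReal_prod]
  simp_rw [← measureReal_def, hfactor]
  rw [Finset.prod_mul_distrib, Finset.prod_ite_eq' Finset.univ k, Finset.prod_ite]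
  simp [Finset.filter_gt_eq_Iio]

lemma one_sub_pow_mul_cond_real_le [NeZero M] {A S : Set Ω} (hA : MeasurableSet A)
    (hS : MeasurableSet S) :
    (1 - (1 - μ.real A) ^ M) * μ[|A].real S ≤
      (Measure.pi fun _ : Fin M => μ).real {w | w (firstIndex A w) ∈ S} := by
  set accepted : Fin M → Set (Fin M → Ω) := fun k => {w | w k ∈ A ∩ S ∧ ∀ j < k, w j ∉ A}
  have hmeas (k : Fin M) : MeasurableSet (accepted k) :=
    (measurable_pi_apply k (hA.inter hS)).inter <| measurableSet_setOfPred.2 <|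
      .forall fun j => .imp measurable_const (hA.mem.comp (measurable_pi_apply j)).not
  have hd : Pairwise (Function.onFun Disjoint accepted) := fun k l hkl =>
    disjoint_left.2 fun w hk hl =>
      hkl ((firstIndex_eq hk.1.1 hk.2).symm.trans (firstIndex_eq hl.1.1 hl.2))
  have hsub : ⋃ k, accepted k ⊆ {w | w (firstIndex A w) ∈ S} := iUnion_subset fun k w hk => by
    rw [mem_ofPred_eq, firstIndex_eq hk.1.1 hk.2]
    exact hk.1.2
  have hcond : μ.real (A ∩ S) = μ.real A * μ[|A].real S := by
    rw [Measure.real, ← cond_mul_eq_inter hA, ENNReal.toReal_mul, mul_comm]; rfl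
  calc (1 - (1 - μ.real A) ^ M) * μ[|A].real S
      = (∑ k ∈ Finset.range M, (1 - μ.real A) ^ k) * μ.real (A ∩ S) := by
        rw [hcond, ← mul_assoc, ← geom_sum_mul_neg, sub_sub_cancel]
    _ = ∑ k : Fin M, (Measure.pi fun _ => μ).real (accepted k) := by
        simp_rw [accepted, pi_real_first_mem μ hA]
        rw [← Finset.sum_mul, ← Finset.sum_range fun k => (1 - μ.real A) ^ k]
    _ = (Measure.pi fun _ => μ).real (⋃ k, accepted k) :=
        (measureReal_iUnion_fintype hd hmeas).symm
    _ ≤ _ := measureReal_mono hsub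

end RejectionSampling

lemma tvDist_le_of_forall_le {Y : Type*} [MeasurableSpace Y] {P Q : Measure Y}
    [IsProbabilityMeasure P] [IsProbabilityMeasure Q] {δ : ℝ}
    (h : ∀ S, MeasurableSet S → (1 - δ) * Q.real S ≤ P.real S) : tvDist P Q ≤ δ := by
  have : Nonempty {S : Set Y // MeasurableSet S} := ⟨⟨∅, .empty⟩⟩
  have hδ : 0 ≤ δ := by simpa using h univ .univ
  refine ciSup_le fun ⟨S, hS⟩ => abs_le.2 ?_
  have hcompl := h Sᶜ hS.compl
  rw [probReal_compl_eq_one_sub hS, probReal_compl_eq_one_sub hS] at hcompl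
  constructor
  · linarith [h S hS, mul_le_of_le_one_right hδ (measureReal_le_one (μ := Q) (s := S))]
  · linarith [mul_nonneg hδ (measureReal_nonneg (μ := Q) (s := S))]

noncomputable section CountingPaths

variable {T : ℝ}

lemma continuousWithinAt_count_Ioc (ω : PointConfig (Icc (0 : ℝ) T)) (t : Icc (0 : ℝ) T) :
    ContinuousWithinAt (fun s : Icc (0 : ℝ) T => count (Subtype.val ⁻¹' Ioc 0 (s : ℝ)) ω)
      (Ici t) t := by
  refine tendsto_finsetSum _ fun j _ => tendsto_nhds_of_eventually_eq ?_
  rcases le_or_gt (ω.2 j : ℝ) t with h | h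
  · filter_upwards [self_mem_nhdsWithin] with s hs
    have hs' : (ω.2 j : ℝ) ≤ s := h.trans hs
    exact indicator_eq_indicator (and_congr_right fun _ => iff_of_true hs' h) rfl
  · filter_upwards [mem_nhdsWithin_of_mem_nhds (Iio_mem_nhds h)] with s hs
    have hs' : ¬ (ω.2 j : ℝ) ≤ s := not_le.2 hs
    exact indicator_eq_indicator (and_congr_right fun _ => iff_of_false hs' h.not_ge) rfl

/-- The counting path of a configuration of points of `[0,T]`; a point at time `0` is ignored,
since counting paths start at `0`. -/
def path (ω : PointConfig (Icc (0 : ℝ) T)) : CountingPath T :=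
  ⟨fun t => count (Subtype.val ⁻¹' Ioc 0 (t : ℝ)) ω,
    fun t ht => by simp [count, ht],
    fun _ _ hst => count_mono (preimage_mono (Ioc_subset_Ioc_right (Subtype.coe_le_coe.2 hst))) ω,
    continuousWithinAt_count_Ioc ω⟩

lemma path_sub (ω : PointConfig (Icc (0 : ℝ) T)) {s t : Icc (0 : ℝ) T} (hst : s ≤ t) :
    (path ω).1 t - (path ω).1 s = count (Ioc s t) ω := by
  have hsplit : count (Subtype.val ⁻¹' Ioc 0 (t : ℝ)) ω =
      count (Subtype.val ⁻¹' Ioc 0 (s : ℝ)) ω + count (Ioc s t) ω := by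
    rw [← Ioc_union_Ioc_eq_Ioc s.2.1 hst, preimage_union,
      count_union ((Ioc_disjoint_Ioc_of_le le_rfl).preimage _)]
    rfl
  exact Nat.sub_eq_of_eq_add' hsplit

lemma measurable_path : Measurable (path (T := T)) :=
  (measurable_pi_lambda _ fun _ =>
    measurable_count (measurable_subtype_coe measurableSet_Ioc)).subtype_mk

lemma measurable_increment (s t : Icc (0 : ℝ) T) :
    Measurable fun y : CountingPath T => y.1 t - y.1 s :=
  ((measurable_pi_apply t).comp measurable_subtype_coe).sub
    ((measurable_pi_apply s).comp measurable_subtype_coe)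

namespace IsPoissonProcess

variable {P : Measure (PointConfig (Icc (0 : ℝ) T))} {ν : Measure (Icc (0 : ℝ) T)}
  [IsFiniteMeasure ν]

lemma hasIndepIncrements_path (hP : IsPoissonProcess P ν) :
    HasIndepIncrements (fun t ω => (path ω).1 t) P := fun n t ht => by
  simp_rw [path_sub _ (ht Fin.castSucc_lt_succ.le)]
  refine hP.iIndepFun_count (fun l => measurableSet_Ioc) ((pairwise_disjoint_on _).2 ?_)
  exact fun k l hkl => Ioc_disjoint_Ioc_of_le (ht (Fin.succ_le_castSucc_iff.2 hkl))

lemma hasLaw_path_sub (hP : IsPoissonProcess P ν) {s t : Icc (0 : ℝ) T} (hst : s ≤ t) :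
    HasLaw (fun ω => (path ω).1 t - (path ω).1 s) (poissonMeasure (ν (Ioc s t)).toNNReal) P := by
  simp_rw [path_sub _ hst]
  exact hP.hasLaw_count measurableSet_Ioc

end IsPoissonProcess

variable {L : ℕ∞}

/-- The channel output whose path in each band is the counting path of that band's points. -/
def paths (ω : Band L → PointConfig (Icc (0 : ℝ) T)) : Output L T := fun i => path (ω i)

lemma measurable_paths : Measurable (paths (L := L) (T := T)) :=
  measurable_pi_lambda _ fun i => measurable_path.comp (measurable_pi_apply i)

lemma isChannelLaw_map_paths {α : ℝ≥0} {x : Input L T}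
    {P : Band L → Measure (PointConfig (Icc (0 : ℝ) T))} {ν : Band L → Measure (Icc (0 : ℝ) T)}
    [∀ i, IsFiniteMeasure (ν i)] (hP : ∀ i, IsPoissonProcess (P i) (ν i))
    (hν : ∀ i s t, (ν i (Ioc s t)).toNNReal = mean α x i s t) :
    IsChannelLaw α x ((Measure.infinitePi P).map paths) := by
  have (i : Band L) : IsProbabilityMeasure (P i) := (hP i).isProbabilityMeasure
  have hinc (i : Band L) (s t : Icc (0 : ℝ) T) :
      Measurable fun y : Output L T => (y i).1 t - (y i).1 s :=
    (measurable_increment s t).comp (measurable_pi_apply i)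
  have heval (i : Band L) : (Measure.infinitePi P).map (fun ω => ω i) = P i :=
    Measure.infinitePi_map_eval P i
  refine ⟨Measure.isProbabilityMeasure_map measurable_paths.aemeasurable, ?_, fun i n t ht => ?_,
    fun i s t hst => ⟨(hinc i s t).aemeasurable, ?_⟩⟩
  · exact (iIndepFun_map_iff measurable_paths fun i => measurable_pi_apply i).2
      (iIndepFun_infinitePi (X := fun _ => path) fun _ => measurable_path)
  · refine (iIndepFun_map_iff measurable_paths fun l => hinc i _ _).2 ?_
    refine (iIndepFun_map_iff (measurable_pi_apply i) fun l =>
      (measurable_increment (t (Fin.castSucc l)) (t l.succ)).comp measurable_path).1 ?_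
    rw [heval]
    exact (hP i).hasIndepIncrements_path n t ht
  · have hlaw := ((hP i).hasLaw_path_sub hst.le).comp
      ⟨(measurable_pi_apply i).aemeasurable, heval i⟩
    rw [Measure.map_map (hinc i s t) measurable_paths, ← hν]
    exact hlaw.map_eq

end CountingPaths

noncomputable section RejectionScheme

variable {L : ℕ∞} {T : ℝ}

lemma SimScheme.measurable_output {M : ℕ} (S : SimScheme L T M) (x : Input L T) :
    Measurable fun w => S.g w (S.f w x) :=
  (measurable_from_prod_countable_left (f := fun q : S.W × Fin M => S.g q.1 q.2)
    S.measurable_g).comp (measurable_id.prodMk (S.measurable_f x))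

/-- Lebesgue measure on `[0,T]`, the intensity of a rate-one Poisson process. -/
abbrev leb (T : ℝ) : Measure (Icc (0 : ℝ) T) := volume.comap Subtype.val

lemma leb_univ : leb T univ = ENNReal.ofReal T := by
  rw [(MeasurableEmbedding.subtype_coe measurableSet_Icc).comap_apply, image_univ,
    Subtype.range_coe, Real.volume_Icc, sub_zero]

instance : IsFiniteMeasure (leb T) := ⟨by rw [leb_univ]; exact ENNReal.ofReal_lt_top⟩

instance [hT : Fact (0 < T)] : NeZero (leb T) :=
  ⟨fun h => by simpa [h, hT.out.not_ge] using leb_univ (T := T)⟩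

lemma measurableSet_preimage_band (x : Input L T) (i : Band L) : MeasurableSet (x.1 ⁻¹' {i}) :=
  x.2 (measurableSet_singleton i)

lemma mean_zero (x : Input L T) (i : Band L) (s t : Icc (0 : ℝ) T) :
    mean 0 x i s t = ((leb T).restrict (x.1 ⁻¹' {i})ᶜ (Ioc s t)).toNNReal := by
  have hx := (measurableSet_preimage_band x i).compl
  have hintensity : (fun τ => intensity 0 x i τ) = (x.1 ⁻¹' {i})ᶜ.indicator 1 := by
    ext τ
    by_cases h : x.1 τ = i <;> simp [intensity, h]
  rw [mean, hintensity, integral_indicator_one hx, measureReal_restrict_apply hx, measureReal_def,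
    ENNReal.toNNReal_toReal_eq, Measure.restrict_apply measurableSet_Ioc, inter_comm]

lemma hasSum_leb_real_preimage_band (hT : 0 ≤ T) (x : Input L T) :
    HasSum (fun i : Band L => (leb T).real (x.1 ⁻¹' {i})) T := by
  have hd : Pairwise (Function.onFun Disjoint fun i : Band L => x.1 ⁻¹' {i}) := fun i j hij =>
    (disjoint_singleton.2 hij).preimage _
  have hunion : ⋃ i : Band L, x.1 ⁻¹' {i} = univ := by
    rw [← preimage_iUnion, iUnion_of_singleton, preimage_univ]
  have hsum : ∑' i : Band L, leb T (x.1 ⁻¹' {i}) = ENNReal.ofReal T := by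
    rw [← measure_iUnion hd (measurableSet_preimage_band x), hunion, leb_univ]
  have hreal := ENNReal.hasSum_toReal (hsum ▸ ENNReal.ofReal_ne_top)
  rwa [← ENNReal.tsum_toReal_eq fun i => measure_ne_top _ _, hsum,
    ENNReal.toReal_ofReal hT] at hreal

/-- The law of one sample: independent rate-one Poisson processes in all bands. -/
def sampleLaw (L : ℕ∞) (T : ℝ) : Measure (Band L → PointConfig (Icc (0 : ℝ) T)) :=
  Measure.infinitePi fun _ => poissonPoints (leb T)

/-- The event that a sample is accepted under the input `x`: at no time does it have a point in the
band that `x` blocks. -/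
def accept (x : Input L T) : Set (Band L → PointConfig (Icc (0 : ℝ) T)) :=
  univ.pi fun i => count (x.1 ⁻¹' {i}) ⁻¹' {0}

lemma measurableSet_accept (x : Input L T) : MeasurableSet (accept x) :=
  .univ_pi fun i => measurableSet_count_eq_zero (measurableSet_preimage_band x i)

variable [hT : Fact (0 < T)]

instance : IsProbabilityMeasure (poissonPoints (leb T)) :=
  (isPoissonProcess_poissonPoints _).isProbabilityMeasure

instance : IsProbabilityMeasure (sampleLaw L T) := by
  unfold sampleLaw; infer_instance

lemma sampleLaw_real_accept (x : Input L T) :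
    (sampleLaw L T).real (accept x) = Real.exp (-T) := by
  have hvoid (i : Band L) : poissonPoints (leb T) (count (x.1 ⁻¹' {i}) ⁻¹' {0}) =
      ENNReal.ofReal (Real.exp (-(leb T).real (x.1 ⁻¹' {i}))) := by
    rw [← (isPoissonProcess_poissonPoints _).real_count_eq_zero (measurableSet_preimage_band x i),
      ofReal_measureReal]
  have hprod : HasProd (fun i : Band L => poissonPoints (leb T) (count (x.1 ⁻¹' {i}) ⁻¹' {0}))
      (ENNReal.ofReal (Real.exp (-T))) := by
    simp_rw [hvoid]
    refine (ENNReal.tendsto_ofReal (hasSum_leb_real_preimage_band hT.out.le x).neg.rexp).congr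
      fun F => ?_
    exact ENNReal.ofReal_prod_of_nonneg fun i _ => (Real.exp_pos _).le
  rw [sampleLaw, accept, measureReal_def, Measure.infinitePi_pi_univ _
    fun i => measurableSet_count_eq_zero (measurableSet_preimage_band x i), hprod.tprod_eq,
    ENNReal.toReal_ofReal (Real.exp_pos _).le]

lemma sampleLaw_accept_ne_zero (x : Input L T) : sampleLaw L T (accept x) ≠ 0 := by
  have hpos : 0 < (sampleLaw L T).real (accept x) := sampleLaw_real_accept x ▸ Real.exp_pos _
  exact fun h => hpos.ne' (by rw [measureReal_def, h, ENNReal.toReal_zero])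

lemma isChannelLaw_cond_accept (x : Input L T) :
    IsChannelLaw 0 x ((sampleLaw L T)[|accept x].map paths) := by
  rw [sampleLaw, accept, infinitePi_cond_univ_pi _
    (fun i => measurableSet_count_eq_zero (measurableSet_preimage_band x i))
    (sampleLaw_accept_ne_zero x)]
  exact isChannelLaw_map_paths
    (fun i => (isPoissonProcess_poissonPoints _).cond_count_eq_zero
      (measurableSet_preimage_band x i))
    fun i s t => (mean_zero x i s t).symm

/-- The rejection sampling scheme: the common randomness consists of `M` independent samples, and
the message is the index of the first accepted one. -/
def rejectionScheme (L : ℕ∞) (T : ℝ) [Fact (0 < T)] (M : ℕ) [NeZero M] : SimScheme L T M where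
  W := Fin M → Band L → PointConfig (Icc (0 : ℝ) T)
  law := Measure.pi fun _ => sampleLaw L T
  f w x := firstIndex (accept x) w
  measurable_f x := measurable_firstIndex (measurableSet_accept x)
  g w k := paths (w k)
  measurable_g k := measurable_paths.comp (measurable_pi_apply k)

lemma simulable_rejection (L : ℕ∞) (T : ℝ) [Fact (0 < T)] (M : ℕ) [NeZero M] :
    Simulable L 0 T M ((1 - Real.exp (-T)) ^ M) := by
  refine ⟨rejectionScheme L T M, fun x => ⟨_, isChannelLaw_cond_accept x, ?_⟩⟩
  have hmeas := (rejectionScheme L T M).measurable_output x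
  have := cond_isProbabilityMeasure (sampleLaw_accept_ne_zero x)
  have := Measure.isProbabilityMeasure_map (μ := (sampleLaw L T)[|accept x])
    measurable_paths.aemeasurable
  have : IsProbabilityMeasure ((rejectionScheme L T M).outputLaw x) :=
    Measure.isProbabilityMeasure_map hmeas.aemeasurable
  refine tvDist_le_of_forall_le fun S hS => ?_
  rw [SimScheme.outputLaw, map_measureReal_apply hmeas hS,
    map_measureReal_apply measurable_paths hS, ← sampleLaw_real_accept x]
  exact one_sub_pow_mul_cond_real_le _ (measurableSet_accept x) (measurable_paths hS)

end RejectionScheme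

section Bounds

variable {L : ℕ∞} {α : ℝ≥0} {T : ℝ} {M : ℕ} {ε ε' : ℝ}

lemma Simulable.mono (h : Simulable L α T M ε) (hε : ε ≤ ε') : Simulable L α T M ε' := by
  obtain ⟨S, hS⟩ := h
  refine ⟨S, fun x => ?_⟩
  obtain ⟨Q, hQ, hle⟩ := hS x
  exact ⟨Q, hQ, hle.trans hε⟩

lemma Simulable.Msim_le (h : Simulable L α T M ε) (hM : 1 ≤ M) : Msim L α T ε ≤ M :=
  iInf₂_le M ⟨hM, h⟩

lemma Simulable.epsSim_le (h : Simulable L α T M ε) (hM : 1 ≤ M) :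
    epsSim L α T M ≤ ENNReal.ofReal ε :=
  iInf₂_le ε.toNNReal ((h.mono (Real.le_coe_toNNReal ε)).Msim_le hM)

lemma one_sub_pow_le_exp_neg_mul {p : ℝ} (hp : p ≤ 1) (M : ℕ) :
    (1 - p) ^ M ≤ Real.exp (-(p * M)) :=
  calc (1 - p) ^ M ≤ Real.exp (-p) ^ M :=
        pow_le_pow_left₀ (sub_nonneg.2 hp) (Real.one_sub_le_exp_neg p) M
    _ = Real.exp (-(p * M)) := by rw [← Real.exp_nat_mul]; ring_nf

lemma log_natCast_mono : Monotone fun n : ℕ => Real.log n := fun m n hmn => by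
  rcases m.eq_zero_or_pos with rfl | hm
  · simpa using Real.log_natCast_nonneg n
  · exact Real.log_le_log (by exact_mod_cast hm) (by exact_mod_cast hmn)

lemma log_natCeil_le (a : ℝ) : Real.log ⌈a⌉₊ ≤ max (Real.log a + Real.log 2) 0 := by
  rcases le_or_gt a 1 with h | h
  · have hceil : (⌈a⌉₊ : ℝ) ≤ 1 := by exact_mod_cast Nat.ceil_le.2 (by simpa using h)
    exact le_max_of_le_right (Real.log_nonpos (Nat.cast_nonneg _) hceil)
  · have hceil : (⌈a⌉₊ : ℝ) ≤ a * 2 := by linarith [Nat.ceil_lt_add_one (zero_le_one.trans h.le)]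
    rw [← Real.log_mul (by positivity) two_ne_zero]
    exact le_max_of_le_left (Real.log_le_log (by positivity) hceil)

/-- `⌈e^T ln (1/ε)⌉`, the number of messages with which rejection sampling reaches the error `ε`. -/
noncomputable def messages (T ε : ℝ) : ℕ := ⌈Real.exp T * Real.log (1 / ε)⌉₊

lemma one_le_messages (hε0 : 0 < ε) (hε1 : ε < 1) : 1 ≤ messages T ε :=
  Nat.ceil_pos.2 (mul_pos (Real.exp_pos T) (Real.log_pos (one_lt_one_div hε0 hε1)))

lemma exp_neg_mul_messages_le (hε : 0 < ε) :
    Real.exp (-(Real.exp (-T) * messages T ε)) ≤ ε := by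
  have hceil : Real.log (1 / ε) ≤ Real.exp (-T) * messages T ε :=
    calc Real.log (1 / ε) = Real.exp (-T) * (Real.exp T * Real.log (1 / ε)) := by
          rw [← mul_assoc, ← Real.exp_add, neg_add_cancel, Real.exp_zero, one_mul]
      _ ≤ _ := by gcongr; exact Nat.le_ceil _
  rw [← Real.le_log_iff_exp_le hε, neg_le]
  simpa using hceil

lemma log_messages_le (hε0 : 0 < ε) (hε1 : ε < 1) :
    Real.log (messages T ε) ≤ max (T + Real.log (Real.log (1 / ε)) + Real.log 2) 0 := by
  have hlog : 0 < Real.log (1 / ε) := Real.log_pos (one_lt_one_div hε0 hε1)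
  have h := log_natCeil_le (Real.exp T * Real.log (1 / ε))
  rwa [Real.log_mul (Real.exp_ne_zero T) hlog.ne', Real.log_exp] at h

lemma exists_Msim_eq_of_le (h : Msim L α T ε ≤ M) : ∃ m : ℕ, Msim L α T ε = m ∧ m ≤ M := by
  obtain ⟨m, hm⟩ := ENat.ne_top_iff_exists.1 (h.trans_lt (ENat.natCast_lt_top M)).ne
  exact ⟨m, hm.symm, by rwa [← hm, Nat.cast_le] at h⟩

end Bounds

end OCPC

theorem theorem4_general (L : ℕ∞) (T : ℝ) (hT : 0 < T) :
    (∀ M : ℕ, 1 ≤ M →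
      OCPC.epsSim L 0 T M ≤ ENNReal.ofReal ((1 - Real.exp (-T)) ^ M) ∧
      (1 - Real.exp (-T)) ^ M ≤ Real.exp (-(Real.exp (-T) * M))) ∧
    (∀ ε : ℝ, 0 < ε → ε < 1 →
      ∃ m : ℕ, OCPC.Msim L 0 T ε = m ∧
        Real.log m ≤ max (T + Real.log (Real.log (1 / ε)) + Real.log 2) 0) := by
  have : Fact (0 < T) := ⟨hT⟩
  have hsim (M : ℕ) (hM : 1 ≤ M) : OCPC.Simulable L 0 T M ((1 - Real.exp (-T)) ^ M) :=
    have : NeZero M := ⟨Nat.one_le_iff_ne_zero.1 hM⟩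
    OCPC.simulable_rejection L T M
  have hpow (M : ℕ) : (1 - Real.exp (-T)) ^ M ≤ Real.exp (-(Real.exp (-T) * M)) :=
    OCPC.one_sub_pow_le_exp_neg_mul (Real.exp_le_one_iff.2 (neg_nonpos.2 hT.le)) M
  refine ⟨fun M hM => ⟨(hsim M hM).epsSim_le hM, hpow M⟩, fun ε hε0 hε1 => ?_⟩
  have hM := OCPC.one_le_messages (T := T) hε0 hε1
  have hle : OCPC.Msim L 0 T ε ≤ OCPC.messages T ε :=
    ((hsim _ hM).mono ((hpow _).trans (OCPC.exp_neg_mul_messages_le hε0))).Msim_le hM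
  obtain ⟨m, hm, hmM⟩ := OCPC.exists_Msim_eq_of_le hle
  exact ⟨m, hm, (OCPC.log_natCast_mono hmM).trans (OCPC.log_messages_le hε0 hε1)⟩

theorem theorem4 (T : ℝ) (hT : 0 < T) :
    (∀ M : ℕ, 1 ≤ M →
      OCPC.epsSim ⊤ 0 T M ≤ ENNReal.ofReal ((1 - Real.exp (-T)) ^ M) ∧
      (1 - Real.exp (-T)) ^ M ≤ Real.exp (-(Real.exp (-T) * M))) ∧
    (∀ ε : ℝ, 0 < ε → ε < 1 →
      ∃ m : ℕ, OCPC.Msim ⊤ 0 T ε = m ∧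
        Real.log m ≤ max (T + Real.log (Real.log (1 / ε)) + Real.log 2) 0) :=
  theorem4_general ⊤ T hT
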